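/- **Setting.** Let $U$ and $X$ be real Banach spaces, with $U\subset X$ a subspace carrying its own complete norm for which the inclusion is continuous, such that $X=U\oplus N_{p^*}$ with $N_{p^*}=\mathrm{span}\{p_1^*,\dots,p_{N_0}^*\}$. Let $p_1,\dots,p_{N_0}\in X'$ vanish on $U$ and satisfy $\langle p^*_m,p_n\rangle=\delta_{m,n}$, and put $N_p=\mathrm{span}\{p_n\}$. The dual $U'$ of $U$ is identified with $\{s\in X': \langle p_n^*,s\rangle=0 \text{ for all } n\}$ (extension of functionals by $0$ on $N_{p^*}$), so that $X'=U'\oplus N_p$; for $f\in X'$ let $\|f\|_{U'}$ be the dual norm of the $U'$-component of $f$, a semi-norm on $X'$ with null space $N_p$. Let $\nu_1,\dots,\nu_M\in X$ be linearly independent, $M>N_0$, $N_\nu=\mathrm{span}\{\nu_m\}$, and $\boldsymbol\nu(f)=(\langle\nu_1,f\rangle,\dots,\langle\nu_M,f\rangle)$ for $f\in X'$. Assume that the vectors $\mathbf v_n=\boldsymbol\nu(p_n)\in\mathbb R^M$, $n=1,\dots,N_0$, are linearly independent, and let $\mathbf u_1,\dots,\mathbf u_{M-N_0}\in\mathbb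 R^M$ be such that $\mathbb R^M=\mathrm{span}\{\mathbf v_n\}\oplus\mathrm{span}\{\mathbf u_m\}$. Let $E:\mathbb R^M\times\mathbb R^M\to[0,+\infty]$ and $\mathbf y\in\mathbb R^M$ be such that $E(\mathbf y,\cdot)$ is proper, lower semicontinuous, convex and coercive ($E(\mathbf y,\mathbf z)\to\infty$ as $\|\mathbf z\|\to\infty$). Let $\psi:[0,\infty)\to[0,\infty)$ be strictly increasing and convex. For $u\in U$ write $J(u)=\{s\in U':\|s\|_{U'}=\|u\|_U,\ \langle u,s\rangle=\|u\|_U\|s\|_{U'}\}$ for the set of its $(U',U)$-conjugates. **Claim.** The solution set $$S=\arg\min_{f\in X'}\big(E(\mathbf y,\boldsymbol\nu(f))+\psi(\|f\|_{U'})\big)$$ is nonempty, convex and weak*-compact. There are unique vectors $\widetilde{\mathbf u}_1,\dots,\widetilde{\mathbf u}_{M-N_0}\in\mathbb R^M$ with $\widetilde{\mathbf u}_m^T\mathbf v_n=0$ and $\widetilde{\mathbf u}_m^T\mathbf u_{m'}=\delta_{m,m'}$, and the elements $\widetilde\nu_m=\sum_{j=1}^M[\widetilde{\mathbf u}_m]_j\,\nu_j$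 lie in $U$ and are linearly independent. Suppose in addition that $E(\mathbf y,\cdot)$ is strictly convex (on the set where it is finite), or that it imposes the equality constraint $\boldsymbol\nu(f)=\mathbf y$ ($E(\mathbf y,\mathbf z)=+\infty$ for $\mathbf z\ne\mathbf y$). Then there is $\mathbf a\in\mathbb R^{M-N_0}$ such that, with $\widetilde\nu_0=\sum_{m=1}^{M-N_0}a_m\widetilde\nu_m\in N_\nu\cap U$, every $f_0\in S$ has a unique decomposition $f_0=p_0+s_0$ with $p_0\in N_p$ and $s_0\in U'$, and $s_0\in J(\widetilde\nu_0)$ ($\widetilde\nu_0$ being common to all solutions). Moreover: * If $U'$ is a Hilbert space and $\psi$ is strictly convex, the solution is unique and $f_0=\sum_{m=1}^{M-N_0}a_m\varphi_m+\sum_{n=1}^{N_0}b_np_n$ for some $\mathbf b\in\mathbb R^{N_0}$, where $\varphi_m\in U'$ is the image of $\widetilde\nu_m$ under the Riesz map $U\to U'$. * If $U'$ is strictly convex, then $J$ is single-valued, $J(u)=\{\mathrm J_U\{u\}\}$, the solution is unique, and $f_0=\mathrm J_U\big\{\sum_{m=1}^{M-N_0}a_m\widetilde\nu_m\big\}+\sum_{n=1}^{N_0}b_np_n$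 for some $\mathbf b\in\mathbb R^{N_0}$. * In all cases (in particular when $U'$ is not strictly convex), $S$ is the weak*-closure of the convex hull of its extreme points, and every extreme point of $S$ can be written as $f_0=\sum_{k=1}^{K_0}c_ke_k+\sum_{n=1}^{N_0}b_np_n$ with $K_0\le M-N_0$, $c_k,b_n\in\mathbb R$, and $e_1,\dots,e_{K_0}$ extreme points of the unit ball of $U'$. * If $E(\mathbf y,\cdot)$ is strictly convex and $N_{p^*}\subset N_\nu$, there is a unique $\mathbf b\in\mathbb R^{N_0}$ such that every $f_0\in S$ has null-space component $p_0=\sum_{n=1}^{N_0}b_np_n$. -/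

import Mathlib

open scoped NNReal ENNReal Topology

namespace SemiNormRep

/-- The `(U', U)`-duality mapping `J(u)`: all functionals `s` in the dual `U'` with
`‖s‖ = ‖u‖` and `⟨u, s⟩ = ‖u‖ ‖s‖`. -/
def dualityMap {U : Type*} [NormedAddCommGroup U] [NormedSpace ℝ U] (u : U) :
    Set (StrongDual ℝ U) :=
  {s | ‖s‖ = ‖u‖ ∧ s u = ‖u‖ * ‖s‖}

/-- `J` is the duality operator of `U`: the duality mapping is single-valued, with value `J u`. -/
def IsDualityOperator {U : Type*} [NormedAddCommGroup U] [NormedSpace ℝ U]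
    (J : U → StrongDual ℝ U) : Prop :=
  ∀ u, dualityMap u = {J u}

/-- `R` is the Riesz map `u ↦ ⟪u, ·⟫` of the Hilbert space `U`; the inner product is written
through the norm by polarization. -/
def IsRieszMap {U : Type*} [NormedAddCommGroup U] [NormedSpace ℝ U]
    (R : U ≃ₗᵢ[ℝ] StrongDual ℝ U) : Prop :=
  ∀ u v, R u v = (‖u + v‖ ^ 2 - ‖u - v‖ ^ 2) / 4

/-- A dual pair `X = U ⊕ N_{p*}`, `X' = U' ⊕ N_p`. The Banach space `U` carries its own norm and is
continuously embedded in `X`; `N_{p*}` is spanned by `p*_1, …, p*_{N₀}`, and `N_p`, the dual of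
`N_{p*}`, by the biorthonormal functionals `p_1, …, p_{N₀}`, which vanish on `U`. -/
structure SplitPair (X U : Type*) [NormedAddCommGroup X] [NormedSpace ℝ X]
    [NormedAddCommGroup U] [NormedSpace ℝ U] (N₀ : ℕ) where
  /-- the inclusion `U ⊆ X` -/
  incl : U →L[ℝ] X
  incl_injective : Function.Injective incl
  /-- the basis of the null space `N_p ⊆ X'` -/
  p : Fin N₀ → StrongDual ℝ X
  /-- the biorthonormal basis of `N_{p*} ⊆ X` -/
  pstar : Fin N₀ → X
  isCompl : IsCompl incl.range (Submodule.span ℝ (Set.range pstar))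
  biorthonormal : ∀ m n, p n (pstar m) = if m = n then 1 else 0
  p_incl : ∀ n u, p n (incl u) = 0

namespace SplitPair

variable {X U : Type*} [NormedAddCommGroup X] [NormedSpace ℝ X] [NormedAddCommGroup U]
  [NormedSpace ℝ U] {N₀ : ℕ}

/-- The null space `N_p = span {p_n} ⊆ X'`. -/
def nullSpace (D : SplitPair X U N₀) : Submodule ℝ (StrongDual ℝ X) :=
  Submodule.span ℝ (Set.range D.p)

/-- The projector `X' → U'`. As an element of the dual of `U`, the `U'`-component of `f` is the
restriction of `f` to `U`, because `N_p` vanishes on `U`. -/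
def dualProj (D : SplitPair X U N₀) (f : StrongDual ℝ X) : StrongDual ℝ U :=
  f.comp D.incl

/-- The semi-norm `‖f‖_{U'} = ‖Proj_{U'} f‖_{U'}` on `X'`. -/
noncomputable def semiNorm (D : SplitPair X U N₀) (f : StrongDual ℝ X) : ℝ≥0 :=
  ‖D.dualProj f‖₊

/-- The projector `X → U` along `N_{p*}`. -/
noncomputable def proj [CompleteSpace X] [CompleteSpace U] (D : SplitPair X U N₀) : X →L[ℝ] U :=
  haveI : FiniteDimensional ℝ (Submodule.span ℝ (Set.range D.pstar)) :=
    FiniteDimensional.span_of_finite ℝ (Set.finite_range D.pstar)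
  haveI : CompleteSpace (Submodule.span ℝ (Set.range D.pstar)) := FiniteDimensional.complete ℝ _
  (ContinuousLinearMap.fst ℝ U (Submodule.span ℝ (Set.range D.pstar))).comp
    (D.incl.coprodSubtypeLEquivOfIsCompl D.isCompl
      (LinearMap.ker_eq_bot.2 D.incl_injective)).symm.toContinuousLinearMap

/-- The inclusion `U' ⊆ X'`: a functional on `U` is extended by `0` on `N_{p*}`. -/
noncomputable def dualIncl [CompleteSpace X] [CompleteSpace U] (D : SplitPair X U N₀)
    (s : StrongDual ℝ U) : StrongDual ℝ X :=
  s.comp D.proj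

end SplitPair

/-- The measurement operator `f ↦ (⟨ν_1, f⟩, …, ⟨ν_M, f⟩)`. -/
def measure {X : Type*} [NormedAddCommGroup X] [NormedSpace ℝ X] {M : ℕ} (ν : Fin M → X)
    (f : StrongDual ℝ X) : Fin M → ℝ :=
  fun m => f (ν m)

/-- The vectors `v_n ∈ ℝ^M` with `[v_n]_m = ⟨ν_m, p_n⟩`. -/
def crossVec {X U : Type*} [NormedAddCommGroup X] [NormedSpace ℝ X] [NormedAddCommGroup U]
    [NormedSpace ℝ U] {N₀ M : ℕ} (D : SplitPair X U N₀) (ν : Fin M → X) :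
    Fin N₀ → Fin M → ℝ :=
  fun n => measure ν (D.p n)

/-- `w` is biorthogonal to `u` and orthogonal to `v`: `w_mᵀ v_n = 0` and `w_mᵀ u_{m'} = δ_{m,m'}`. -/
def IsBiorthogonal {M N₀ K : ℕ} (v : Fin N₀ → Fin M → ℝ) (u w : Fin K → Fin M → ℝ) : Prop :=
  (∀ m n, w m ⬝ᵥ v n = 0) ∧ ∀ m m', w m ⬝ᵥ u m' = if m = m' then 1 else 0

/-- The functional `E(y, ν(f)) + ψ(‖f‖_{U'})`, with values in `[0, ∞]`. -/
noncomputable def objective {X U : Type*} [NormedAddCommGroup X] [NormedSpace ℝ X]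
    [NormedAddCommGroup U] [NormedSpace ℝ U] {N₀ M : ℕ} (D : SplitPair X U N₀) (ν : Fin M → X)
    (E : (Fin M → ℝ) → (Fin M → ℝ) → ℝ≥0∞) (ψ : ℝ≥0 → ℝ≥0) (y : Fin M → ℝ)
    (f : StrongDual ℝ X) : ℝ≥0∞ :=
  E y (measure ν f) + (ψ (D.semiNorm f) : ℝ≥0∞)

/-- The set of all minimizers over `X'`. -/
def solutionSet {X U : Type*} [NormedAddCommGroup X] [NormedSpace ℝ X]
    [NormedAddCommGroup U] [NormedSpace ℝ U] {N₀ M : ℕ} (D : SplitPair X U N₀) (ν : Fin M → X)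
    (E : (Fin M → ℝ) → (Fin M → ℝ) → ℝ≥0∞) (ψ : ℝ≥0 → ℝ≥0) (y : Fin M → ℝ) :
    Set (StrongDual ℝ X) :=
  {f | ∀ g, objective D ν E ψ y f ≤ objective D ν E ψ y g}

/-- Strict convexity of a `[0, ∞]`-valued function: strict inequality between any two distinct
points at which the function is finite. -/
def ExtStrictConvex {M : ℕ} (F : (Fin M → ℝ) → ℝ≥0∞) : Prop :=
  StrictConvexOn ℝ≥0 {z | F z ≠ ⊤} F

end SemiNormRep

namespace SemiNormRep

/-! ### Faces of closed bounded convex sets and extreme points -/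

section Faces

variable {V : Type*} [NormedAddCommGroup V] [NormedSpace ℝ V] {F : Set V}

/-- The segment from `y` to `x` can be prolonged beyond `x` inside `F`; for `y ∈ F` this says that
`y` lies in the smallest face of `F` containing `x`. -/
def Prolongable (F : Set V) (x y : V) : Prop :=
  ∃ η : ℝ, 0 < η ∧ x + η • (x - y) ∈ F

/-- The directions in which one can move both forwards and backwards from `x` inside `F`. -/
def faceDirection (hF : Convex ℝ F) {x : V} (hx : x ∈ F) : Submodule ℝ V where
  carrier := {d | ∃ ε : ℝ, 0 < ε ∧ x + ε • d ∈ F ∧ x - ε • d ∈ F}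
  zero_mem' := ⟨1, one_pos, by simpa using hx, by simpa using hx⟩
  add_mem' := by
    rintro d₁ d₂ ⟨ε₁, h₁, ha₁, hb₁⟩ ⟨ε₂, h₂, ha₂, hb₂⟩
    have hs : 0 < ε₁ + ε₂ := by positivity
    have hw : ε₂ / (ε₁ + ε₂) + ε₁ / (ε₁ + ε₂) = 1 := by field_simp; ring
    refine ⟨ε₁ * ε₂ / (ε₁ + ε₂), by positivity, ?_, ?_⟩
    · convert hF ha₁ ha₂ (by positivity) (by positivity) hw using 1
      match_scalars <;> field_simp <;> ring
    · convert hF hb₁ hb₂ (by positivity) (by positivity) hw using 1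
      match_scalars <;> field_simp <;> ring
  smul_mem' := by
    rintro c d ⟨ε, hε, ha, hb⟩
    rcases lt_trichotomy c 0 with hc | rfl | hc
    · have hc' : c ≠ 0 := hc.ne
      refine ⟨ε / (-c), div_pos hε (neg_pos.2 hc), ?_, ?_⟩
      · convert hb using 1
        match_scalars <;> field_simp
      · convert ha using 1
        match_scalars <;> field_simp
    · exact ⟨1, one_pos, by simpa using hx, by simpa using hx⟩
    · refine ⟨ε / c, div_pos hε hc, ?_, ?_⟩
      · convert ha using 1
        match_scalars <;> field_simp
      · convert hb using 1
        match_scalars <;> field_simp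

theorem Prolongable.trans (hF : Convex ℝ F) {x y z : V} (hxy : Prolongable F x y)
    (hyz : Prolongable F y z) : Prolongable F x z := by
  obtain ⟨η, hη, hq⟩ := hxy
  obtain ⟨θ, hθ, hr⟩ := hyz
  have hpos : 0 < 1 + θ + η := by positivity
  refine ⟨η * θ / (1 + θ + η), by positivity, ?_⟩
  have hw : (1 + θ) / (1 + θ + η) + η / (1 + θ + η) = 1 := by field_simp
  convert hF hq hr (by positivity) (by positivity) hw using 1
  match_scalars <;> field_simp <;> ring

theorem faceDirection_mono (hF : Convex ℝ F) {x y : V} (hx : x ∈ F) (hy : y ∈ F)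
    (hxy : Prolongable F x y) : faceDirection hF hy ≤ faceDirection hF hx := by
  rintro d ⟨ε, hε, ha, hb⟩
  obtain ⟨η, hη, hq⟩ := hxy
  have hw : 1 / (1 + η) + η / (1 + η) = 1 := by field_simp
  refine ⟨η * ε / (1 + η), by positivity, ?_, ?_⟩
  · convert hF hq ha (by positivity) (by positivity) hw using 1
    match_scalars <;> field_simp <;> ring
  · convert hF hq hb (by positivity) (by positivity) hw using 1
    match_scalars <;> field_simp <;> ring

theorem mem_extremePoints_of_faceDirection_eq_bot (hF : Convex ℝ F) {x : V} (hx : x ∈ F)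
    (h : faceDirection hF hx = ⊥) : x ∈ F.extremePoints ℝ := by
  refine ⟨hx, fun a ha b hb ⟨s, t, hs, ht, hst, hab⟩ => ?_⟩
  have hd : a - b ∈ faceDirection hF hx := by
    refine ⟨s * t, by positivity, ?_, ?_⟩
    · have hw : (s + s * t) + t * t = 1 := by nlinarith
      convert hF ha hb (by positivity) (by positivity) hw using 1
      rw [← hab]
      have : t = 1 - s := by linarith
      subst this
      match_scalars <;> ring
    · have hw : s * s + (t + s * t) = 1 := by nlinarith
      convert hF ha hb (by positivity) (by positivity) hw using 1
      rw [← hab]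
      have : t = 1 - s := by linarith
      subst this
      match_scalars <;> ring
  rw [h, Submodule.mem_bot, sub_eq_zero] at hd
  subst hd
  rw [← hab, ← add_smul, hst, one_smul]

/-- In a closed bounded convex set, the segment from `y` through `x` can be prolonged up to a last
point, whose smallest face is strictly smaller than that of `x`. -/
theorem exists_faceDirection_lt (hF : Convex ℝ F) (hcl : IsClosed F)
    (hb : Bornology.IsBounded F) {x y : V} (hx : x ∈ F) (hy : y ∈ F) (hne : x ≠ y)
    (hxy : Prolongable F x y) :
    ∃ (z : V) (hz : z ∈ F), Prolongable F x z ∧ x ∈ segment ℝ y z ∧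
      faceDirection hF hz < faceDirection hF hx := by
  have hd : 0 < ‖x - y‖ := norm_pos_iff.2 (sub_ne_zero.2 hne)
  obtain ⟨R, hR⟩ := hb.subset_closedBall x
  obtain ⟨η, hη, hq⟩ := hxy
  have hcomp : IsCompact {t : ℝ | 0 ≤ t ∧ x + t • (x - y) ∈ F} := by
    refine Metric.isCompact_of_isClosed_isBounded ?_ ?_
    · exact isClosed_Ici.inter (hcl.preimage (by fun_prop))
    · refine (Metric.isBounded_Icc 0 (R / ‖x - y‖)).subset fun t ht => ⟨ht.1, ?_⟩
      have := hR ht.2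
      rw [Metric.mem_closedBall, dist_eq_norm, add_sub_cancel_left, norm_smul,
        Real.norm_of_nonneg ht.1] at this
      rwa [le_div_iff₀ hd]
  obtain ⟨t, ⟨-, htF⟩, htmax⟩ := hcomp.exists_isGreatest ⟨η, hη.le, hq⟩
  have ht : 0 < t := hη.trans_le (htmax ⟨hη.le, hq⟩)
  have hxz : Prolongable F x (x + t • (x - y)) := by
    refine ⟨1 / t, by positivity, ?_⟩
    convert hy using 1
    match_scalars <;> field_simp <;> ring
  refine ⟨_, htF, hxz, ⟨t / (1 + t), 1 / (1 + t), by positivity, by positivity,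
    by field_simp; ring, ?_⟩, lt_of_le_of_ne (faceDirection_mono hF hx htF hxz) fun heq => ?_⟩
  · match_scalars <;> field_simp <;> ring
  · have hmem : x - y ∈ faceDirection hF hx := by
      have hw : 1 / (1 + η) + η / (1 + η) = 1 := by field_simp
      refine ⟨η / (1 + η), by positivity, ?_, ?_⟩
      · convert hF hq hx (by positivity) (by positivity) hw using 1
        match_scalars <;> field_simp
      · convert hF hx hy (by positivity) (by positivity) hw using 1
        match_scalars <;> field_simp <;> ring
    rw [← heq] at hmem
    obtain ⟨ε, hε, hmem, -⟩ := hmem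
    have hle : t + ε ≤ t := htmax ⟨by positivity, by
      convert hmem using 1
      module⟩
    linarith

theorem exists_extremePoint_prolongable (hF : Convex ℝ F) (hcl : IsClosed F)
    (hb : Bornology.IsBounded F) {x : V} (hx : x ∈ F)
    [hfd : FiniteDimensional ℝ (faceDirection hF hx)] :
    ∃ e ∈ F.extremePoints ℝ, Prolongable F x e := by
  induction hn : Module.finrank ℝ (faceDirection hF hx) using Nat.strong_induction_on
    generalizing x with
  | _ n ih =>
    by_cases hbot : faceDirection hF hx = ⊥
    · exact ⟨x, mem_extremePoints_of_faceDirection_eq_bot hF hx hbot, 1, one_pos, by simpa using hx⟩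
    · obtain ⟨d, ⟨ε, hε, hd₁, hd₂⟩, hd0⟩ := Submodule.exists_mem_ne_zero_of_ne_bot hbot
      obtain ⟨z, hz, hxz, -, hlt⟩ := exists_faceDirection_lt hF hcl hb hx hd₂
        (by simpa [eq_comm (a := x), hε.ne'] using hd0) ⟨1, one_pos, by simpa using hd₁⟩
      have : FiniteDimensional ℝ (faceDirection hF hz) := Submodule.finiteDimensional_of_le hlt.le
      obtain ⟨e, he, hze⟩ := ih _ (hn ▸ Submodule.finrank_lt_finrank_of_lt hlt) hz rfl
      exact ⟨e, he, hxz.trans hF hze⟩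

/-- A point of a closed bounded convex set whose smallest face has dimension `n` is a convex
combination of at most `n + 1` extreme points. -/
theorem exists_finset_extremePoints (hF : Convex ℝ F) (hcl : IsClosed F)
    (hb : Bornology.IsBounded F) {x : V} (hx : x ∈ F)
    [hfd : FiniteDimensional ℝ (faceDirection hF hx)] :
    ∃ T : Finset V, (T : Set V) ⊆ F.extremePoints ℝ ∧
      T.card ≤ Module.finrank ℝ (faceDirection hF hx) + 1 ∧ x ∈ convexHull ℝ (T : Set V) := by
  classical
  induction hn : Module.finrank ℝ (faceDirection hF hx) using Nat.strong_induction_on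
    generalizing x with
  | _ n ih =>
    obtain ⟨e, he, hxe⟩ := exists_extremePoint_prolongable hF hcl hb hx
    by_cases hne : x = e
    · subst hne
      exact ⟨{x}, by simpa using he, by simp, by simp⟩
    · obtain ⟨z, hz, -, hseg, hlt⟩ := exists_faceDirection_lt hF hcl hb hx he.1 hne hxe
      have : FiniteDimensional ℝ (faceDirection hF hz) := Submodule.finiteDimensional_of_le hlt.le
      have hlt' := Submodule.finrank_lt_finrank_of_lt hlt
      obtain ⟨T, hT, hcard, hmem⟩ := ih _ (hn ▸ hlt') hz rfl
      refine ⟨insert e T, ?_, (Finset.card_insert_le _ _).trans (by omega), ?_⟩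
      · rw [Finset.coe_insert]
        exact Set.insert_subset he hT
      · refine (convex_convexHull ℝ _).segment_subset (subset_convexHull ℝ _ (by simp))
          (convexHull_mono (by simp) hmem) hseg

end Faces

/-! ### The duality mapping -/

section Duality

variable {U : Type*} [NormedAddCommGroup U] [NormedSpace ℝ U]

theorem dualityMap_nonempty (u : U) : (dualityMap u).Nonempty := by
  by_cases hu : u = 0
  · subst hu
    exact ⟨0, by simp [dualityMap]⟩
  · obtain ⟨g, hg, hgu⟩ := exists_dual_vector ℝ u (norm_ne_zero_iff.2 hu)
    refine ⟨‖u‖ • g, ?_, ?_⟩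
    · rw [norm_smul, hg, norm_norm, mul_one]
    · rw [norm_smul, hg, norm_norm, mul_one]
      simpa using Or.inl hgu

theorem dualityMap_subsingleton [StrictConvexSpace ℝ (StrongDual ℝ U)] (u : U) :
    (dualityMap u).Subsingleton := by
  rintro s ⟨hs, hsu⟩ t ⟨ht, htu⟩
  by_cases hu : u = 0
  · subst hu
    rw [norm_zero, norm_eq_zero] at hs ht
    rw [hs, ht]
  · have hpos : 0 < ‖u‖ := norm_pos_iff.2 hu
    refine eq_of_norm_eq_of_norm_add_eq (hs.trans ht.symm) (le_antisymm (norm_add_le _ _) ?_)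
    refine le_of_mul_le_mul_right ?_ hpos
    calc (‖s‖ + ‖t‖) * ‖u‖ = (s + t) u := by
          rw [add_apply, hsu, htu]; ring
      _ ≤ ‖s + t‖ * ‖u‖ := (le_abs_self _).trans ((s + t).le_opNorm u)

theorem exists_isDualityOperator [StrictConvexSpace ℝ (StrongDual ℝ U)] :
    ∃ J : U → StrongDual ℝ U, IsDualityOperator J := by
  choose J hJ using dualityMap_nonempty (U := U)
  exact ⟨J, fun u => (dualityMap_subsingleton u).eq_singleton_of_mem (hJ u)⟩

theorem exists_isRieszMap_of_innerProductSpace {H : Type*} [NormedAddCommGroup H]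
    [InnerProductSpace ℝ H] [CompleteSpace H] :
    ∃ R : H ≃ₗᵢ[ℝ] StrongDual ℝ H, IsRieszMap R := by
  refine ⟨⟨⟨⟨⟨InnerProductSpace.toDual ℝ H, map_add _⟩, fun c x => ?_⟩,
    (InnerProductSpace.toDual ℝ H).symm, fun x => ?_, fun x => ?_⟩, fun x => ?_⟩, fun x y => ?_⟩
  · simp
  · simp
  · simp
  · simp
  · have h := real_inner_eq_norm_add_mul_self_sub_norm_mul_self_sub_norm_mul_self_div_two x y
    have hp := parallelogram_law_with_norm_mul ℝ x y
    change inner ℝ x y = _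
    linarith

theorem exists_isRieszMap_of_innerProductSpaceable {H : Type*} [NormedAddCommGroup H]
    [NormedSpace ℝ H] [CompleteSpace H] [InnerProductSpaceable H] :
    ∃ R : H ≃ₗᵢ[ℝ] StrongDual ℝ H, IsRieszMap R :=
  @exists_isRieszMap_of_innerProductSpace H _
    (InnerProductSpace.ofNorm ℝ InnerProductSpaceable.parallelogram_identity) _

theorem innerProductSpaceable_dual {H : Type*} [NormedAddCommGroup H] [NormedSpace ℝ H]
    [CompleteSpace H] [InnerProductSpaceable H] : InnerProductSpaceable (StrongDual ℝ H) := by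
  obtain ⟨R, -⟩ := exists_isRieszMap_of_innerProductSpaceable (H := H)
  refine ⟨fun x y => ?_⟩
  have := InnerProductSpaceable.parallelogram_identity (R.symm x) (R.symm y)
  simpa only [← map_add, ← map_sub, LinearIsometryEquiv.norm_map] using this

theorem innerProductSpaceable_of_dual [InnerProductSpaceable (StrongDual ℝ U)] :
    InnerProductSpaceable U := by
  let L : U →ₗᵢ[ℝ] StrongDual ℝ (StrongDual ℝ U) := NormedSpace.inclusionInDoubleDualLi ℝ
  refine ⟨fun x y => ?_⟩
  have := (innerProductSpaceable_dual (H := StrongDual ℝ U)).parallelogram_identity (L x) (L y)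
  rwa [← L.map_add, ← L.map_sub, L.norm_map, L.norm_map, L.norm_map, L.norm_map] at this

theorem exists_isRieszMap [CompleteSpace U] [InnerProductSpaceable (StrongDual ℝ U)] :
    ∃ R : U ≃ₗᵢ[ℝ] StrongDual ℝ U, IsRieszMap R :=
  have := innerProductSpaceable_of_dual (U := U)
  exists_isRieszMap_of_innerProductSpaceable

theorem IsRieszMap.mem_dualityMap {R : U ≃ₗᵢ[ℝ] StrongDual ℝ U} (hR : IsRieszMap R) (u : U) :
    R u ∈ dualityMap u := by
  refine ⟨R.norm_map u, ?_⟩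
  rw [hR, sub_self, norm_zero, ← two_smul ℝ u, norm_smul, R.norm_map]
  norm_num
  ring

/-- A functional of minimal norm among those with the same values on `ν'` attains its norm at a
linear combination of the `ν' m`. -/
theorem exists_norming_combination {K : ℕ} (ν' : Fin K → U) (s : StrongDual ℝ U)
    (hs : ∀ t : StrongDual ℝ U, (∀ m, t (ν' m) = s (ν' m)) → ‖s‖ ≤ ‖t‖) :
    ∃ a : Fin K → ℝ, s ∈ dualityMap (∑ m, a m • ν' m) := by
  let W := Submodule.span ℝ (Set.range ν')
  have : FiniteDimensional ℝ W := FiniteDimensional.span_of_finite ℝ (Set.finite_range ν')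
  have : ProperSpace W := FiniteDimensional.proper ℝ W
  let r : StrongDual ℝ W := s.comp W.subtypeL
  obtain ⟨g, hg, hgn⟩ := _root_.exists_extension_norm_eq W r
  have hsr : ‖s‖ ≤ ‖r‖ := hgn ▸ hs g fun m => hg ⟨ν' m, Submodule.subset_span ⟨m, rfl⟩⟩
  obtain ⟨w, hw, hmax⟩ := (isCompact_closedBall (0 : W) 1).exists_isMaxOn
    ⟨0, by simp⟩ r.continuous.continuousOn
  have hrw : ‖r‖ ≤ r w := by
    have h0 : 0 ≤ r w := by simpa using hmax (a := 0) (by simp)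
    refine r.opNorm_le_of_unit_norm h0 fun x hx => ?_
    rw [Real.norm_eq_abs, abs_le']
    refine ⟨hmax (by simp [hx]), ?_⟩
    simpa using hmax (a := -x) (by simp [hx])
  have hw1 : ‖(w : U)‖ ≤ 1 := by simpa using hw
  have hsw : s w = ‖s‖ := by
    refine le_antisymm ?_ (hsr.trans hrw)
    calc s w ≤ ‖s‖ * ‖(w : U)‖ := (le_abs_self _).trans (s.le_opNorm _)
      _ ≤ ‖s‖ := mul_le_of_le_one_right (norm_nonneg _) hw1
  obtain ⟨c, hc⟩ := (Submodule.mem_span_range_iff_exists_fun ℝ).1 w.2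
  refine ⟨fun m => ‖s‖ * c m, ?_⟩
  have hsum : ∑ m, (‖s‖ * c m) • ν' m = ‖s‖ • (w : U) := by
    rw [← hc, Finset.smul_sum]
    simp only [mul_smul]
  have hnorm : ‖s‖ * ‖(w : U)‖ = ‖s‖ := by
    refine le_antisymm (mul_le_of_le_one_right (norm_nonneg _) hw1) ?_
    calc ‖s‖ = s w := hsw.symm
      _ ≤ ‖s‖ * ‖(w : U)‖ := (le_abs_self _).trans (s.le_opNorm _)
  rw [hsum]
  refine ⟨?_, ?_⟩
  · rw [norm_smul, norm_norm, hnorm]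
  · rw [norm_smul, norm_norm, hnorm, map_smul, hsw, smul_eq_mul]

end Duality

/-! ### The direct sums `X = U ⊕ N_{p*}` and `X' = U' ⊕ N_p` -/

namespace SplitPair

variable {X U : Type*} [NormedAddCommGroup X] [NormedSpace ℝ X] [NormedAddCommGroup U]
  [NormedSpace ℝ U] {N₀ : ℕ} (D : SplitPair X U N₀)

theorem dualProj_apply (f : StrongDual ℝ X) (u : U) : D.dualProj f u = f (D.incl u) := rfl

theorem dualProj_add (f g : StrongDual ℝ X) :
    D.dualProj (f + g) = D.dualProj f + D.dualProj g := rfl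

theorem dualProj_sum_smul_p (b : Fin N₀ → ℝ) : D.dualProj (∑ n, b n • D.p n) = 0 := by
  ext u
  simp [dualProj_apply, D.p_incl]

theorem sum_smul_p_pstar (b : Fin N₀ → ℝ) (m : Fin N₀) : (∑ n, b n • D.p n) (D.pstar m) = b m := by
  simp [D.biorthonormal]

theorem exists_incl_add_sum (x : X) :
    ∃ (u : U) (c : Fin N₀ → ℝ), D.incl u + ∑ n, c n • D.pstar n = x := by
  have hx : x ∈ D.incl.range ⊔ Submodule.span ℝ (Set.range D.pstar) :=
    D.isCompl.sup_eq_top ▸ Submodule.mem_top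
  obtain ⟨_, ⟨u, rfl⟩, q, hq, rfl⟩ := Submodule.mem_sup.1 hx
  obtain ⟨c, rfl⟩ := (Submodule.mem_span_range_iff_exists_fun ℝ).1 hq
  exact ⟨u, c, rfl⟩

theorem exists_incl_eq {x : X} (hx : ∀ n, D.p n x = 0) : ∃ u, D.incl u = x := by
  obtain ⟨u, c, rfl⟩ := D.exists_incl_add_sum x
  have hc : c = 0 := by
    ext n
    simpa [D.p_incl, D.biorthonormal] using hx n
  exact ⟨u, by simp [hc]⟩

theorem dual_ext {f g : StrongDual ℝ X} (h₁ : D.dualProj f = D.dualProj g)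
    (h₂ : ∀ n, f (D.pstar n) = g (D.pstar n)) : f = g := by
  ext x
  obtain ⟨u, c, rfl⟩ := D.exists_incl_add_sum x
  have : f (D.incl u) = g (D.incl u) := DFunLike.congr_fun h₁ u
  simp [this, h₂]

variable [CompleteSpace X] [CompleteSpace U]

theorem proj_incl_add {q : X} (u : U) (hq : q ∈ Submodule.span ℝ (Set.range D.pstar)) :
    D.proj (D.incl u + q) = u := by
  unfold proj
  have : FiniteDimensional ℝ (Submodule.span ℝ (Set.range D.pstar)) :=
    FiniteDimensional.span_of_finite ℝ (Set.finite_range D.pstar)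
  have : CompleteSpace (Submodule.span ℝ (Set.range D.pstar)) := FiniteDimensional.complete ℝ _
  have h : D.incl u + q = D.incl.coprodSubtypeLEquivOfIsCompl D.isCompl
      (LinearMap.ker_eq_bot.2 D.incl_injective) (u, ⟨q, hq⟩) := rfl
  rw [h]
  simp

theorem proj_incl (u : U) : D.proj (D.incl u) = u := by
  simpa using D.proj_incl_add u (Submodule.zero_mem _)

theorem proj_pstar (n : Fin N₀) : D.proj (D.pstar n) = 0 := by
  simpa using D.proj_incl_add 0 (Submodule.subset_span (Set.mem_range_self n))

theorem dualProj_dualIncl (s : StrongDual ℝ U) : D.dualProj (D.dualIncl s) = s := by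
  ext u
  change s (D.proj (D.incl u)) = s u
  rw [proj_incl]

theorem dualIncl_pstar (s : StrongDual ℝ U) (n : Fin N₀) : D.dualIncl s (D.pstar n) = 0 := by
  change s (D.proj (D.pstar n)) = 0
  rw [proj_pstar, map_zero]

theorem dualIncl_incl (s : StrongDual ℝ U) (u : U) : D.dualIncl s (D.incl u) = s u :=
  DFunLike.congr_fun (D.dualProj_dualIncl s) u

theorem eq_dualIncl_add_sum (f : StrongDual ℝ X) :
    f = D.dualIncl (D.dualProj f) + ∑ n, f (D.pstar n) • D.p n := by
  refine D.dual_ext ?_ fun n => ?_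
  · rw [dualProj_add, dualProj_dualIncl, dualProj_sum_smul_p, add_zero]
  · rw [_root_.add_apply, dualIncl_pstar, sum_smul_p_pstar, zero_add]

theorem eq_of_eq_dualIncl_add_sum {f : StrongDual ℝ X} {s : StrongDual ℝ U} {b : Fin N₀ → ℝ}
    (h : f = D.dualIncl s + ∑ n, b n • D.p n) : s = D.dualProj f ∧ ∀ n, b n = f (D.pstar n) := by
  subst h
  refine ⟨?_, fun n => ?_⟩
  · rw [dualProj_add, dualProj_dualIncl, dualProj_sum_smul_p, add_zero]
  · rw [_root_.add_apply, dualIncl_pstar, sum_smul_p_pstar, zero_add]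

end SplitPair

/-! ### Measurements -/

section Measure

variable {X U : Type*} [NormedAddCommGroup X] [NormedSpace ℝ X] [NormedAddCommGroup U]
  [NormedSpace ℝ U] {N₀ M : ℕ} (D : SplitPair X U N₀) (ν : Fin M → X)

theorem measure_add (f g : StrongDual ℝ X) : measure ν (f + g) = measure ν f + measure ν g := rfl

theorem measure_smul (c : ℝ) (f : StrongDual ℝ X) : measure ν (c • f) = c • measure ν f := rfl

theorem dotProduct_measure (w : Fin M → ℝ) (f : StrongDual ℝ X) :
    w ⬝ᵥ measure ν f = f (∑ j, w j • ν j) := by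
  simp [dotProduct, measure]

theorem measure_surjective (hν : LinearIndependent ℝ ν) : Function.Surjective (measure ν) := by
  intro z
  let B := Module.Basis.span hν
  have : FiniteDimensional ℝ (Submodule.span ℝ (Set.range ν)) :=
    FiniteDimensional.span_of_finite ℝ (Set.finite_range ν)
  obtain ⟨g, hg, -⟩ := exists_extension_norm_eq (𝕜 := ℝ) (Submodule.span ℝ (Set.range ν))
    (LinearMap.toContinuousLinearMap (B.constr ℝ z))
  refine ⟨g, funext fun m => ?_⟩
  have h := hg (B m)
  rw [LinearMap.coe_toContinuousLinearMap', Module.Basis.constr_basis] at h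
  rw [← h]
  exact congrArg (fun x : Submodule.span ℝ (Set.range ν) => g x)
    (Module.Basis.span_apply hν m).symm

/-- A functional on `X` can be recovered linearly and continuously from its restriction to `U` and
its measurements. -/
theorem exists_reconstruction [CompleteSpace X] [CompleteSpace U]
    (hv : LinearIndependent ℝ (crossVec D ν)) :
    ∃ G : StrongDual ℝ U × (Fin M → ℝ) →L[ℝ] StrongDual ℝ X,
      (∀ f, G (D.dualProj f, measure ν f) = f) ∧ (∀ s z, D.dualProj (G (s, z)) = s) ∧
      ∀ s z, z - measure ν (D.dualIncl s) ∈ Submodule.span ℝ (Set.range (crossVec D ν)) →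
        measure ν (G (s, z)) = z := by
  obtain ⟨L, hL⟩ := (Fintype.linearCombination ℝ (crossVec D ν)).exists_leftInverse_of_injective
    (LinearMap.ker_eq_bot.2 hv.fintypeLinearCombination_injective)
  replace hL : ∀ b : Fin N₀ → ℝ, L (∑ n, b n • crossVec D ν n) = b := fun b =>
    DFunLike.congr_fun hL b
  let I : StrongDual ℝ U →L[ℝ] StrongDual ℝ X := (ContinuousLinearMap.compL ℝ X U ℝ).flip D.proj
  let A : StrongDual ℝ X →L[ℝ] (Fin M → ℝ) :=
    ContinuousLinearMap.pi fun m => ContinuousLinearMap.apply ℝ ℝ (ν m)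
  let P : (Fin N₀ → ℝ) →L[ℝ] StrongDual ℝ X :=
    LinearMap.toContinuousLinearMap (Fintype.linearCombination ℝ D.p)
  let Lc : (Fin M → ℝ) →L[ℝ] (Fin N₀ → ℝ) := LinearMap.toContinuousLinearMap L
  let fst := ContinuousLinearMap.fst ℝ (StrongDual ℝ U) (Fin M → ℝ)
  let snd := ContinuousLinearMap.snd ℝ (StrongDual ℝ U) (Fin M → ℝ)
  have hAP : ∀ b : Fin N₀ → ℝ, measure ν (∑ n, b n • D.p n) = ∑ n, b n • crossVec D ν n := fun b => by
    ext m
    simp [measure, crossVec]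
  have hG : ∀ s z, (I.comp fst + P.comp (Lc.comp (snd - A.comp (I.comp fst)))) (s, z) =
      D.dualIncl s + ∑ n, L (z - measure ν (D.dualIncl s)) n • D.p n := fun s z => rfl
  refine ⟨I.comp fst + P.comp (Lc.comp (snd - A.comp (I.comp fst))), fun f => ?_, fun s z => ?_,
    fun s z h => ?_⟩
  · have hf : measure ν f - measure ν (D.dualIncl (D.dualProj f)) =
        ∑ n, f (D.pstar n) • crossVec D ν n := by
      conv_lhs => enter [1]; rw [D.eq_dualIncl_add_sum f]
      rw [measure_add, hAP, add_sub_cancel_left]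
    rw [hG, hf, hL]
    exact (D.eq_dualIncl_add_sum f).symm
  · rw [hG, D.dualProj_add, D.dualProj_dualIncl, D.dualProj_sum_smul_p, add_zero]
  · obtain ⟨b, hb⟩ := (Submodule.mem_span_range_iff_exists_fun ℝ).1 h
    rw [hG, ← hb, hL, measure_add, hAP, hb, add_sub_cancel]

end Measure

/-! ### Biorthogonal systems -/

section Biorthogonal

variable {M N₀ K : ℕ} {v : Fin N₀ → Fin M → ℝ} {u w : Fin K → Fin M → ℝ}

theorem IsBiorthogonal.eq {w' : Fin K → Fin M → ℝ} (h : IsBiorthogonal v u w)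
    (h' : IsBiorthogonal v u w')
    (hvu : Submodule.span ℝ (Set.range v) ⊔ Submodule.span ℝ (Set.range u) = ⊤) : w = w' := by
  funext m
  refine dotProduct_eq _ _ fun x => ?_
  have hx : x ∈ Submodule.span ℝ (Set.range v) ⊔ Submodule.span ℝ (Set.range u) :=
    hvu ▸ Submodule.mem_top
  rw [← Submodule.span_union] at hx
  induction hx using Submodule.span_induction with
  | mem x hx =>
    rcases hx with ⟨n, rfl⟩ | ⟨m', rfl⟩
    · rw [h.1, h'.1]
    · rw [h.2, h'.2]
  | zero => simp
  | add x y _ _ hx hy => rw [dotProduct_add, dotProduct_add, hx, hy]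
  | smul c x _ hx => rw [dotProduct_smul, dotProduct_smul, hx]

theorem IsBiorthogonal.mem_span (h : IsBiorthogonal v u w)
    (hvu : Submodule.span ℝ (Set.range v) ⊔ Submodule.span ℝ (Set.range u) = ⊤)
    {z : Fin M → ℝ} (hz : ∀ m, w m ⬝ᵥ z = 0) : z ∈ Submodule.span ℝ (Set.range v) := by
  have hx : z ∈ Submodule.span ℝ (Set.range v) ⊔ Submodule.span ℝ (Set.range u) :=
    hvu ▸ Submodule.mem_top
  obtain ⟨a, ha, b, hb, rfl⟩ := Submodule.mem_sup.1 hx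
  obtain ⟨d, rfl⟩ := (Submodule.mem_span_range_iff_exists_fun ℝ).1 ha
  obtain ⟨c, rfl⟩ := (Submodule.mem_span_range_iff_exists_fun ℝ).1 hb
  have hc : c = 0 := by
    ext m
    simpa [dotProduct_add, dotProduct_sum, dotProduct_smul, h.1, h.2] using hz m
  simpa [hc] using ha

theorem IsBiorthogonal.linearIndependent (h : IsBiorthogonal v u w) : LinearIndependent ℝ w := by
  rw [Fintype.linearIndependent_iff]
  intro c hc m
  have := congrArg (· ⬝ᵥ u m) hc
  simpa [sum_dotProduct, smul_dotProduct, h.2] using this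

theorem exists_isBiorthogonal (hK : N₀ + K = M)
    (hvu : Submodule.span ℝ (Set.range v) ⊔ Submodule.span ℝ (Set.range u) = ⊤) :
    ∃ w, IsBiorthogonal v u w := by
  have htop : ⊤ ≤ Submodule.span ℝ (Set.range (Sum.elim v u)) := by
    rw [Set.Sum.elim_range, Submodule.span_union, hvu]
  have hcard : Fintype.card (Fin N₀ ⊕ Fin K) = Module.finrank ℝ (Fin M → ℝ) := by simp [hK]
  let B := basisOfTopLeSpanOfCardEqFinrank (Sum.elim v u) htop hcard
  have hB : ∀ i, B i = Sum.elim v u i := fun i => by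
    simp only [B, coe_basisOfTopLeSpanOfCardEqFinrank]
  have hw : ∀ m x, (fun j => B.coord (Sum.inr m) (Pi.single j 1)) ⬝ᵥ x =
      B.repr x (Sum.inr m) := fun m x => by
    have hx : x = ∑ j, x j • Pi.single j (1 : ℝ) := by
      simpa using (pi_eq_sum_univ' x)
    conv_rhs => rw [hx]
    simp [dotProduct, mul_comm]
  refine ⟨fun m j => B.coord (Sum.inr m) (Pi.single j 1), fun m n => ?_, fun m m' => ?_⟩
  · rw [hw]
    have := hB (Sum.inl n)
    rw [Sum.elim_inl] at this
    rw [← this, B.repr_self, Finsupp.single_apply, if_neg (by simp)]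
  · rw [hw]
    have := hB (Sum.inr m')
    rw [Sum.elim_inr] at this
    rw [← this, B.repr_self, Finsupp.single_apply]
    simp [eq_comm]

end Biorthogonal

/-! ### Convex increasing functions on `[0, ∞)` -/

section Regularizer

variable {ψ : ℝ≥0 → ℝ≥0}

theorem convexOn_comp_toNNReal (hmono : Monotone ψ) (hconv : ConvexOn ℝ≥0 Set.univ ψ) :
    ConvexOn ℝ Set.univ fun x : ℝ => (ψ x.toNNReal : ℝ) := by
  refine ⟨convex_univ, fun x _ y _ a b ha hb hab => ?_⟩
  lift a to ℝ≥0 using ha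
  lift b to ℝ≥0 using hb
  have h₁ : ((a : ℝ) • x + (b : ℝ) • y).toNNReal ≤ a • x.toNNReal + b • y.toNNReal := by
    rw [Real.toNNReal_le_iff_le_coe]
    push_cast [smul_eq_mul]
    gcongr <;> exact Real.le_coe_toNNReal _
  have h₂ := (hmono h₁).trans
    (hconv.2 (Set.mem_univ x.toNNReal) (Set.mem_univ y.toNNReal) a.2 b.2 (by exact_mod_cast hab))
  exact_mod_cast h₂

theorem continuous_of_monotone_of_convexOn (hmono : Monotone ψ)
    (hconv : ConvexOn ℝ≥0 Set.univ ψ) : Continuous ψ := by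
  have hc : Continuous fun x : ℝ => (ψ x.toNNReal : ℝ) :=
    continuousOn_univ.1 ((convexOn_comp_toNNReal hmono hconv).continuousOn isOpen_univ)
  have : ψ = fun t : ℝ≥0 => ((fun x : ℝ => (ψ x.toNNReal : ℝ)) t).toNNReal := by
    funext t
    simp
  rw [this]
  exact continuous_real_toNNReal.comp (hc.comp NNReal.continuous_coe)

theorem exists_le_of_apply_le (hmono : StrictMono ψ) (hconv : ConvexOn ℝ≥0 Set.univ ψ)
    (c : ℝ≥0) : ∃ r : ℝ≥0, ∀ t, ψ t ≤ c → t ≤ r := by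
  have h01 : (ψ 0 : ℝ) < ψ 1 := by exact_mod_cast hmono zero_lt_one
  refine ⟨max 1 (c / (ψ 1 - ψ 0 : ℝ)).toNNReal, fun t ht => ?_⟩
  by_cases h1 : t ≤ 1
  · exact le_max_of_le_left h1
  · have ht1 : (1 : ℝ) < t := by exact_mod_cast not_le.1 h1
    have ht0 : (0 : ℝ) < t := one_pos.trans ht1
    refine le_max_of_le_right (NNReal.le_toNNReal_of_coe_le ?_)
    have h := (convexOn_comp_toNNReal hmono.monotone hconv).2 (Set.mem_univ 0)
      (Set.mem_univ (t : ℝ)) (sub_nonneg.2 ((div_le_one ht0).2 ht1.le))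
      (one_div_pos.2 ht0).le (sub_add_cancel 1 (1 / (t : ℝ)))
    have he : ((1 - 1 / t : ℝ) * 0 + (1 / t : ℝ) * t).toNNReal = 1 := by
      rw [mul_zero, zero_add, one_div_mul_cancel ht0.ne', Real.toNNReal_one]
    simp only [smul_eq_mul, he, Real.toNNReal_zero, Real.toNNReal_coe] at h
    have hct : (ψ t : ℝ) ≤ c := by exact_mod_cast ht
    rw [le_div_iff₀ (sub_pos.2 h01)]
    have h' : (t : ℝ) * ψ 1 ≤ (t - 1) * ψ 0 + ψ t := by
      calc (t : ℝ) * ψ 1 ≤ t * ((1 - 1 / t) * ψ 0 + 1 / t * ψ t) := by gcongr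
        _ = (t - 1) * ψ 0 + ψ t := by field_simp
    nlinarith [(ψ 0).2]

end Regularizer

/-! ### Existence of solutions -/

section Existence

variable {X U : Type*} [NormedAddCommGroup X] [NormedSpace ℝ X] [NormedAddCommGroup U]
  [NormedSpace ℝ U] {N₀ M : ℕ} {D : SplitPair X U N₀} {ν : Fin M → X}
  {E : (Fin M → ℝ) → (Fin M → ℝ) → ℝ≥0∞} {ψ : ℝ≥0 → ℝ≥0} {y : Fin M → ℝ}

theorem semiNorm_convexOn : ConvexOn ℝ≥0 Set.univ D.semiNorm := by
  refine ⟨convex_univ, fun f _ g _ a b _ _ _ => ?_⟩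
  calc ‖(a : ℝ) • D.dualProj f + (b : ℝ) • D.dualProj g‖₊
      ≤ ‖(a : ℝ) • D.dualProj f‖₊ + ‖(b : ℝ) • D.dualProj g‖₊ := nnnorm_add_le _ _
    _ = a • D.semiNorm f + b • D.semiNorm g := by
      rw [nnnorm_smul, nnnorm_smul, NNReal.nnnorm_eq, NNReal.nnnorm_eq]; rfl

theorem regularizer_convexOn (hmono : Monotone ψ) (hconv : ConvexOn ℝ≥0 Set.univ ψ) :
    ConvexOn ℝ≥0 Set.univ fun f : StrongDual ℝ X => (ψ (D.semiNorm f) : ℝ≥0∞) := by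
  refine ⟨convex_univ, fun f _ g _ a b ha hb hab => ?_⟩
  have h := (hmono ((semiNorm_convexOn (D := D)).2 (Set.mem_univ f) (Set.mem_univ g) ha hb hab)).trans
    (hconv.2 (Set.mem_univ _) (Set.mem_univ _) ha hb hab)
  have h' := ENNReal.coe_le_coe.2 h
  simpa [ENNReal.smul_def] using h'

theorem objective_convexOn (hE : ConvexOn ℝ≥0 Set.univ (E y)) (hmono : Monotone ψ)
    (hconv : ConvexOn ℝ≥0 Set.univ ψ) : ConvexOn ℝ≥0 Set.univ (objective D ν E ψ y) := by
  have h : ConvexOn ℝ≥0 Set.univ fun f => E y (measure ν f) :=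
    ⟨convex_univ, fun f _ g _ a b ha hb hab =>
      hE.2 (Set.mem_univ (measure ν f)) (Set.mem_univ (measure ν g)) ha hb hab⟩
  exact h.add (regularizer_convexOn hmono hconv)

theorem solutionSet_convex (hE : ConvexOn ℝ≥0 Set.univ (E y)) (hmono : Monotone ψ)
    (hconv : ConvexOn ℝ≥0 Set.univ ψ) : Convex ℝ (solutionSet D ν E ψ y) := by
  intro f hf g hg a b ha hb hab h
  lift a to ℝ≥0 using ha
  lift b to ℝ≥0 using hb
  have hab' : a + b = 1 := by exact_mod_cast hab
  calc objective D ν E ψ y (a • f + b • g)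
      ≤ a • objective D ν E ψ y f + b • objective D ν E ψ y g :=
        (objective_convexOn hE hmono hconv).2 (Set.mem_univ f) (Set.mem_univ g) a.2 b.2 hab'
    _ ≤ a • objective D ν E ψ y h + b • objective D ν E ψ y h := by
        gcongr
        · exact hf h
        · exact hg h
    _ = objective D ν E ψ y h := by rw [← add_smul, hab', one_smul]

theorem semiNorm_lowerSemicontinuous :
    LowerSemicontinuous fun f : WeakDual ℝ X => D.semiNorm (WeakDual.toStrongDual f) := by
  rw [lowerSemicontinuous_iff_isClosed_preimage]
  intro r
  have h : (fun f : WeakDual ℝ X => D.semiNorm (WeakDual.toStrongDual f)) ⁻¹' Set.Iic r =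
      ⋂ u : U, {f : WeakDual ℝ X | ‖f (D.incl u)‖ ≤ r * ‖u‖} := by
    ext f
    rw [Set.mem_preimage, Set.mem_Iic, Set.mem_iInter]
    exact ContinuousLinearMap.opNorm_le_iff (f := D.dualProj (WeakDual.toStrongDual f)) r.2
  rw [h]
  exact isClosed_iInter fun u =>
    isClosed_le (WeakDual.eval_continuous (D.incl u)).norm continuous_const

theorem objective_lowerSemicontinuous (hE : LowerSemicontinuous (E y)) (hmono : Monotone ψ)
    (hconv : ConvexOn ℝ≥0 Set.univ ψ) :
    LowerSemicontinuous fun f : WeakDual ℝ X => objective D ν E ψ y (WeakDual.toStrongDual f) := by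
  have hm : Continuous fun f : WeakDual ℝ X => measure ν (WeakDual.toStrongDual f) :=
    continuous_pi fun m => WeakDual.eval_continuous (ν m)
  have hψ := continuous_of_monotone_of_convexOn hmono hconv
  refine (hE.comp hm).add ?_
  exact ENNReal.continuous_coe.comp_lowerSemicontinuous
    (hψ.comp_lowerSemicontinuous semiNorm_lowerSemicontinuous hmono) ENNReal.coe_mono

theorem exists_objective_ne_top (hν : LinearIndependent ℝ ν) (hE : ∃ z, E y z ≠ ⊤) :
    ∃ f, objective D ν E ψ y f ≠ ⊤ := by
  obtain ⟨z, hz⟩ := hE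
  obtain ⟨f, rfl⟩ := measure_surjective ν hν z
  exact ⟨f, ENNReal.add_ne_top.2 ⟨hz, ENNReal.coe_ne_top⟩⟩

theorem objective_ne_top_of_mem (hν : LinearIndependent ℝ ν) (hE_proper : ∃ z, E y z ≠ ⊤)
    {f : StrongDual ℝ X} (hf : f ∈ solutionSet D ν E ψ y) : objective D ν E ψ y f ≠ ⊤ := by
  obtain ⟨f₁, hf₁⟩ := exists_objective_ne_top (D := D) (ψ := ψ) hν hE_proper
  exact ne_top_of_le_ne_top hf₁ (hf f₁)

variable [CompleteSpace X] [CompleteSpace U]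

theorem isBounded_sublevel (hv : LinearIndependent ℝ (crossVec D ν))
    (hE : Filter.Tendsto (E y) (Filter.cocompact (Fin M → ℝ)) (𝓝 ⊤)) (hmono : StrictMono ψ)
    (hconv : ConvexOn ℝ≥0 Set.univ ψ) {c : ℝ≥0∞} (hc : c ≠ ⊤) :
    Bornology.IsBounded {f | objective D ν E ψ y f ≤ c} := by
  obtain ⟨G, hG, -, -⟩ := exists_reconstruction D ν hv
  obtain ⟨r, hr⟩ := exists_le_of_apply_le hmono hconv c.toNNReal
  obtain ⟨C, hC, hCE⟩ := Filter.mem_cocompact.1 (hE.eventually (lt_mem_nhds hc.lt_top))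
  refine (G.lipschitz.isBounded_image
    ((Metric.isBounded_closedBall (x := (0 : StrongDual ℝ U)) (r := r)).prod hC.isBounded)).subset
    fun f hf => ⟨(D.dualProj f, measure ν f), ⟨?_, ?_⟩, hG f⟩
  · have h : (ψ (D.semiNorm f) : ℝ≥0∞) ≤ c := le_add_self.trans hf
    have h' := hr _ (ENNReal.coe_le_coe.1 (h.trans_eq (ENNReal.coe_toNNReal hc).symm))
    rw [mem_closedBall_zero_iff]
    exact h'
  · by_contra hn
    have hlt : c < E y (measure ν f) := hCE hn
    exact absurd (le_self_add.trans hf) (not_le.2 hlt)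

theorem isCompact_sublevel (hv : LinearIndependent ℝ (crossVec D ν))
    (hE_lsc : LowerSemicontinuous (E y))
    (hE : Filter.Tendsto (E y) (Filter.cocompact (Fin M → ℝ)) (𝓝 ⊤)) (hmono : StrictMono ψ)
    (hconv : ConvexOn ℝ≥0 Set.univ ψ) {c : ℝ≥0∞} (hc : c ≠ ⊤) :
    IsCompact {f : WeakDual ℝ X | objective D ν E ψ y (WeakDual.toStrongDual f) ≤ c} :=
  WeakDual.isCompact_of_bounded_of_closed
    (isBounded_sublevel (D := D) (ν := ν) hv hE hmono hconv hc)
    ((objective_lowerSemicontinuous hE_lsc hmono.monotone hconv).isClosed_preimage c)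

theorem solutionSet_nonempty (hν : LinearIndependent ℝ ν)
    (hv : LinearIndependent ℝ (crossVec D ν)) (hE_proper : ∃ z, E y z ≠ ⊤)
    (hE_lsc : LowerSemicontinuous (E y))
    (hE : Filter.Tendsto (E y) (Filter.cocompact (Fin M → ℝ)) (𝓝 ⊤)) (hmono : StrictMono ψ)
    (hconv : ConvexOn ℝ≥0 Set.univ ψ) : (solutionSet D ν E ψ y).Nonempty := by
  obtain ⟨f₁, hf₁⟩ := exists_objective_ne_top (D := D) (ψ := ψ) hν hE_proper
  obtain ⟨f, hf, hmin⟩ := LowerSemicontinuousOn.exists_isMinOn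
    ⟨StrongDual.toWeakDual f₁, le_refl (objective D ν E ψ y f₁)⟩
    (isCompact_sublevel (D := D) (ν := ν) hv hE_lsc hE hmono hconv hf₁)
    ((objective_lowerSemicontinuous (D := D) (ν := ν) hE_lsc hmono.monotone
      hconv).lowerSemicontinuousOn _)
  refine ⟨WeakDual.toStrongDual f, fun g => ?_⟩
  by_cases hg : objective D ν E ψ y g ≤ objective D ν E ψ y f₁
  · exact hmin (a := StrongDual.toWeakDual g) hg
  · exact le_trans hf (not_le.1 hg).le

theorem solutionSet_isCompact (hν : LinearIndependent ℝ ν)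
    (hv : LinearIndependent ℝ (crossVec D ν)) (hE_proper : ∃ z, E y z ≠ ⊤)
    (hE_lsc : LowerSemicontinuous (E y))
    (hE : Filter.Tendsto (E y) (Filter.cocompact (Fin M → ℝ)) (𝓝 ⊤)) (hmono : StrictMono ψ)
    (hconv : ConvexOn ℝ≥0 Set.univ ψ) :
    IsCompact (StrongDual.toWeakDual '' solutionSet D ν E ψ y) := by
  obtain ⟨f₀, hf₀⟩ := solutionSet_nonempty hν hv hE_proper hE_lsc hE hmono hconv
  convert isCompact_sublevel (D := D) (ν := ν) hv hE_lsc hE hmono hconv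
    (objective_ne_top_of_mem hν hE_proper hf₀) using 1
  ext f
  constructor
  · rintro ⟨g, hg, rfl⟩
    exact hg f₀
  · exact fun hf => ⟨WeakDual.toStrongDual f, fun g => le_trans hf (hf₀ g), rfl⟩

end Existence

/-! ### The duality mapping as a face of a ball -/

section DualityFace

variable {U : Type*} [NormedAddCommGroup U] [NormedSpace ℝ U]

theorem mem_dualityMap_iff {u : U} {s : StrongDual ℝ U} :
    s ∈ dualityMap u ↔ ‖s‖ ≤ ‖u‖ ∧ ‖u‖ * ‖u‖ ≤ s u := by
  have hle : s u ≤ ‖s‖ * ‖u‖ := (le_abs_self _).trans (s.le_opNorm u)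
  refine ⟨fun ⟨h₁, h₂⟩ => ⟨h₁.le, by rw [h₂, h₁]⟩, fun ⟨h₁, h₂⟩ => ?_⟩
  have h₃ : ‖s‖ = ‖u‖ := by
    rcases (norm_nonneg u).eq_or_lt with h | h
    · exact le_antisymm h₁ (h ▸ norm_nonneg s)
    · exact le_antisymm h₁ (le_of_mul_le_mul_right (h₂.trans hle) h)
  refine ⟨h₃, le_antisymm ?_ ?_⟩
  · rw [mul_comm]
    exact hle
  · rw [h₃]
    exact h₂

theorem dualityMap_eq_inter (u : U) :
    dualityMap u = Metric.closedBall 0 ‖u‖ ∩ {s | ‖u‖ * ‖u‖ ≤ s u} := by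
  ext s
  rw [mem_dualityMap_iff, Set.mem_inter_iff, mem_closedBall_zero_iff]
  rfl

theorem dualityMap_convex (u : U) : Convex ℝ (dualityMap u) := by
  rw [dualityMap_eq_inter]
  exact (convex_closedBall _ _).inter
    (convex_halfSpace_ge (ContinuousLinearMap.apply ℝ ℝ u).isLinear _)

theorem dualityMap_isClosed (u : U) : IsClosed (dualityMap u) := by
  rw [dualityMap_eq_inter]
  exact Metric.isClosed_closedBall.inter
    (isClosed_le continuous_const (ContinuousLinearMap.apply ℝ ℝ u).continuous)

theorem dualityMap_isBounded (u : U) : Bornology.IsBounded (dualityMap u) := by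
  rw [dualityMap_eq_inter]
  exact Metric.isBounded_closedBall.subset Set.inter_subset_left

theorem inv_norm_smul_mem_extremePoints_closedBall {u : U} (hu : u ≠ 0) {e : StrongDual ℝ U}
    (he : e ∈ (dualityMap u).extremePoints ℝ) :
    ‖u‖⁻¹ • e ∈ (Metric.closedBall (0 : StrongDual ℝ U) 1).extremePoints ℝ := by
  have hpos : 0 < ‖u‖ := norm_pos_iff.2 hu
  have hnorm : ∀ a ∈ Metric.closedBall (0 : StrongDual ℝ U) 1, ‖‖u‖ • a‖ ≤ ‖u‖ ∧
      (‖u‖ • a) u ≤ ‖u‖ * ‖u‖ := fun a ha => by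
    rw [mem_closedBall_zero_iff] at ha
    have h : ‖‖u‖ • a‖ ≤ ‖u‖ := by
      rw [norm_smul, norm_norm]
      exact mul_le_of_le_one_right hpos.le ha
    refine ⟨h, (le_abs_self _).trans (((‖u‖ • a).le_opNorm u).trans ?_)⟩
    gcongr
  have heu : e u = ‖u‖ * ‖u‖ := by rw [he.1.2, he.1.1]
  refine ⟨?_, fun a ha b hb ⟨p, q, hp, hq, hpq, hab⟩ => ?_⟩
  · rw [mem_closedBall_zero_iff, norm_smul, norm_inv, norm_norm, he.1.1, inv_mul_cancel₀ hpos.ne']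
  · have hab' : p • ‖u‖ • a + q • ‖u‖ • b = e := by
      have : ‖u‖ • (p • a + q • b) = e := by rw [hab, smul_inv_smul₀ hpos.ne']
      rw [← this]
      module
    have hval : p * (‖u‖ • a) u + q * (‖u‖ • b) u = ‖u‖ * ‖u‖ := by
      rw [← heu, ← hab']
      rfl
    obtain ⟨ha₁, ha₂⟩ := hnorm a ha
    obtain ⟨hb₁, hb₂⟩ := hnorm b hb
    have hq' : q = 1 - p := by linarith
    subst hq'
    have ha₃ : ‖u‖ * ‖u‖ ≤ (‖u‖ • a) u := by nlinarith
    have hb₃ : ‖u‖ * ‖u‖ ≤ (‖u‖ • b) u := by nlinarith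
    have := he.2 (mem_dualityMap_iff.2 ⟨ha₁, ha₃⟩) (mem_dualityMap_iff.2 ⟨hb₁, hb₃⟩)
      ⟨p, 1 - p, hp, hq, hpq, hab'⟩
    rw [← this, inv_smul_smul₀ hpos.ne']

theorem apply_eq_zero_of_mem_faceDirection {u : U} {s d : StrongDual ℝ U}
    (hs : s ∈ dualityMap u) (hd : d ∈ faceDirection (dualityMap_convex u) hs) : d u = 0 := by
  obtain ⟨ε, hε, h₁, h₂⟩ := hd
  have e₁ : (s + ε • d) u = ‖u‖ * ‖u‖ := by rw [h₁.2, h₁.1]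
  have e₂ : (s - ε • d) u = ‖u‖ * ‖u‖ := by rw [h₂.2, h₂.1]
  simp only [add_apply, sub_apply, smul_apply, smul_eq_mul] at e₁ e₂
  have : ε * d u = 0 := by linarith
  exact (mul_eq_zero.1 this).resolve_left hε.ne'

/-- If the values on `ν'` separate the directions of the smallest face of `s` in `J(∑ a_m ν'_m)`,
then `s` is a linear combination of at most `K` extreme points of the unit ball. -/
theorem exists_sum_smul_extremePoints {K : ℕ} {ν' : Fin K → U} {a : Fin K → ℝ}
    {s : StrongDual ℝ U} (hs : s ∈ dualityMap (∑ m, a m • ν' m))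
    (hd : ∀ d ∈ faceDirection (dualityMap_convex _) hs, (∀ m, d (ν' m) = 0) → d = 0) :
    ∃ K₀ ≤ K, ∃ (c : Fin K₀ → ℝ) (e : Fin K₀ → StrongDual ℝ U),
      (∀ k, e k ∈ (Metric.closedBall (0 : StrongDual ℝ U) 1).extremePoints ℝ) ∧
      s = ∑ k, c k • e k := by
  by_cases hu : ∑ m, a m • ν' m = 0
  · refine ⟨0, K.zero_le, Fin.elim0, Fin.elim0, fun k => k.elim0, ?_⟩
    have := hs.1
    rw [hu, norm_zero, norm_eq_zero] at this
    simpa using this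
  set u := ∑ m, a m • ν' m with hu_def
  have hpos : 0 < ‖u‖ := norm_pos_iff.2 hu
  let V := faceDirection (dualityMap_convex u) hs
  let Φ : V →ₗ[ℝ] (Fin K → ℝ) :=
    { toFun := fun d m => (d : StrongDual ℝ U) (ν' m)
      map_add' := fun _ _ => rfl
      map_smul' := fun _ _ => rfl }
  have hΦ : Function.Injective Φ := by
    rw [injective_iff_map_eq_zero]
    exact fun d h => Subtype.ext (hd d d.2 fun m => congrFun h m)
  have : FiniteDimensional ℝ V := FiniteDimensional.of_injective Φ hΦ
  have hrank : Module.finrank ℝ V < K := by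
    rw [← LinearMap.finrank_range_of_inj hΦ]
    conv_rhs => rw [← Module.finrank_fin_fun ℝ (n := K)]
    refine Submodule.finrank_lt fun htop => ?_
    obtain ⟨d, hda⟩ := LinearMap.range_eq_top.1 htop a
    have h0 := apply_eq_zero_of_mem_faceDirection hs d.2
    rw [hu_def, map_sum] at h0
    have hda' : ∀ m, (d : StrongDual ℝ U) (ν' m) = a m := fun m => congrFun hda m
    simp only [map_smul, hda', smul_eq_mul] at h0
    have ha : ∀ m, a m = 0 := fun m => mul_self_eq_zero.1
      ((Finset.sum_eq_zero_iff_of_nonneg fun i _ => mul_self_nonneg (a i)).1 h0 m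
        (Finset.mem_univ m))
    exact hu (by simp [hu_def, ha])
  obtain ⟨T, hT, hcard, hmem⟩ := exists_finset_extremePoints (dualityMap_convex u)
    (dualityMap_isClosed u) (dualityMap_isBounded u) hs
  obtain ⟨c, -, -, hc⟩ := Finset.mem_convexHull'.1 hmem
  refine ⟨T.card, hcard.trans hrank, fun k => c (T.equivFin.symm k) * ‖u‖,
    fun k => ‖u‖⁻¹ • (T.equivFin.symm k : StrongDual ℝ U),
    fun k => inv_norm_smul_mem_extremePoints_closedBall hu (hT (T.equivFin.symm k).2), ?_⟩
  rw [← hc, ← Finset.sum_coe_sort, ← T.equivFin.symm.sum_comp]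
  refine Finset.sum_congr rfl fun k _ => ?_
  rw [mul_smul, smul_inv_smul₀ hpos.ne']

end DualityFace

/-! ### Structure of the solution set -/

section Structure

variable {X U : Type*} [NormedAddCommGroup X] [NormedSpace ℝ X] [NormedAddCommGroup U]
  [NormedSpace ℝ U] {N₀ M : ℕ} {D : SplitPair X U N₀} {ν : Fin M → X}
  {E : (Fin M → ℝ) → (Fin M → ℝ) → ℝ≥0∞} {ψ : ℝ≥0 → ℝ≥0} {y : Fin M → ℝ}

theorem measure_eq_of_extStrictConvex (hν : LinearIndependent ℝ ν) (hE_proper : ∃ z, E y z ≠ ⊤)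
    (hE : ExtStrictConvex (E y)) (hmono : Monotone ψ) (hconv : ConvexOn ℝ≥0 Set.univ ψ)
    {f g : StrongDual ℝ X} (hf : f ∈ solutionSet D ν E ψ y) (hg : g ∈ solutionSet D ν E ψ y) :
    measure ν f = measure ν g := by
  by_contra hne
  have hft := objective_ne_top_of_mem hν hE_proper hf
  have hgt := objective_ne_top_of_mem hν hE_proper hg
  have hhalf : (0 : ℝ≥0) < 1 / 2 := by positivity
  have hsum : (1 / 2 : ℝ≥0) + 1 / 2 = 1 := add_halves 1
  have h₁ := hE.2 (x := measure ν f) (y := measure ν g) (ENNReal.add_ne_top.1 hft).1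
    (ENNReal.add_ne_top.1 hgt).1 hne hhalf hhalf hsum
  have h₂ := (regularizer_convexOn (D := D) hmono hconv).2 (Set.mem_univ f) (Set.mem_univ g)
    hhalf.le hhalf.le hsum
  have hfg : objective D ν E ψ y f = objective D ν E ψ y g := le_antisymm (hf g) (hg f)
  have h₃ : objective D ν E ψ y ((1 / 2 : ℝ≥0) • f + (1 / 2 : ℝ≥0) • g) <
      objective D ν E ψ y f := by
    calc objective D ν E ψ y ((1 / 2 : ℝ≥0) • f + (1 / 2 : ℝ≥0) • g)
        < ((1 / 2 : ℝ≥0) • E y (measure ν f) + (1 / 2 : ℝ≥0) • E y (measure ν g)) +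
          ((1 / 2 : ℝ≥0) • (ψ (D.semiNorm f) : ℝ≥0∞) +
            (1 / 2 : ℝ≥0) • (ψ (D.semiNorm g) : ℝ≥0∞)) :=
          ENNReal.add_lt_add_of_lt_of_le ENNReal.coe_ne_top h₁ h₂
      _ = (1 / 2 : ℝ≥0) • objective D ν E ψ y f + (1 / 2 : ℝ≥0) • objective D ν E ψ y g := by
          simp only [objective, smul_add]
          abel
      _ = objective D ν E ψ y f := by rw [← hfg, ← add_smul, hsum, one_smul]
  exact absurd (hf _) (not_le.2 h₃)

theorem measure_eq_of_constraint (hν : LinearIndependent ℝ ν) (hE_proper : ∃ z, E y z ≠ ⊤)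
    (hE : ∀ z, z ≠ y → E y z = ⊤) {f : StrongDual ℝ X} (hf : f ∈ solutionSet D ν E ψ y) :
    measure ν f = y := by
  by_contra hne
  exact (ENNReal.add_ne_top.1 (objective_ne_top_of_mem hν hE_proper hf)).1 (hE _ hne)

theorem semiNorm_le_of_mem_solutionSet (hν : LinearIndependent ℝ ν) (hE_proper : ∃ z, E y z ≠ ⊤)
    (hmono : StrictMono ψ) {f g : StrongDual ℝ X} (hf : f ∈ solutionSet D ν E ψ y)
    (hfg : measure ν f = measure ν g) : D.semiNorm f ≤ D.semiNorm g := by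
  have h := hf g
  have hft := (ENNReal.add_ne_top.1 (objective_ne_top_of_mem hν hE_proper hf)).1
  rw [objective, objective, ← hfg, ENNReal.add_le_add_iff_left hft, ENNReal.coe_le_coe] at h
  exact hmono.le_iff_le.1 h

theorem mem_solutionSet_of_semiNorm_le (hmono : Monotone ψ) {f g : StrongDual ℝ X}
    (hf : f ∈ solutionSet D ν E ψ y) (hfg : measure ν g = measure ν f)
    (hle : D.semiNorm g ≤ D.semiNorm f) : g ∈ solutionSet D ν E ψ y := by
  refine fun h => le_trans ?_ (hf h)
  rw [objective, objective, hfg]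
  gcongr
  exact hmono hle

theorem exists_reduced_basis {K : ℕ} (hν : LinearIndependent ℝ ν) {u w : Fin K → Fin M → ℝ}
    (hw : IsBiorthogonal (crossVec D ν) u w) :
    ∃ ν' : Fin K → U, (∀ m, D.incl (ν' m) = ∑ j, w m j • ν j) ∧ LinearIndependent ℝ ν' := by
  have hex : ∀ m, ∃ u, D.incl u = ∑ j, w m j • ν j := fun m =>
    D.exists_incl_eq fun n => (dotProduct_measure ν (w m) (D.p n)).symm.trans (hw.1 m n)
  choose ν' hν' using hex
  refine ⟨ν', hν', Fintype.linearIndependent_iff.2 fun c hc => ?_⟩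
  have h := congrArg D.incl hc
  simp only [map_sum, map_smul, hν', map_zero, Finset.smul_sum, smul_smul] at h
  rw [Finset.sum_comm] at h
  simp only [← Finset.sum_smul] at h
  refine Fintype.linearIndependent_iff.1 hw.linearIndependent c (funext fun j => ?_)
  simpa using Fintype.linearIndependent_iff.1 hν _ h j

variable {K : ℕ} {u w : Fin K → Fin M → ℝ} {ν' : Fin K → U}

theorem apply_incl_eq_of_measure_eq (hν' : ∀ m, D.incl (ν' m) = ∑ j, w m j • ν j)
    {f g : StrongDual ℝ X} (h : measure ν f = measure ν g) (m : Fin K) :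
    D.dualProj f (ν' m) = D.dualProj g (ν' m) := by
  rw [D.dualProj_apply, D.dualProj_apply, hν', ← dotProduct_measure, ← dotProduct_measure, h]

variable [CompleteSpace X] [CompleteSpace U]

theorem eq_of_dualProj_eq_of_measure_eq (hv : LinearIndependent ℝ (crossVec D ν))
    {f g : StrongDual ℝ X} (h₁ : D.dualProj f = D.dualProj g) (h₂ : measure ν f = measure ν g) :
    f = g := by
  obtain ⟨G, hG, -, -⟩ := exists_reconstruction D ν hv
  rw [← hG f, ← hG g, h₁, h₂]

theorem exists_dualProj_eq_measure_eq (hv : LinearIndependent ℝ (crossVec D ν))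
    (hu : Submodule.span ℝ (Set.range (crossVec D ν)) ⊔ Submodule.span ℝ (Set.range u) = ⊤)
    (hw : IsBiorthogonal (crossVec D ν) u w) (hν' : ∀ m, D.incl (ν' m) = ∑ j, w m j • ν j)
    (f : StrongDual ℝ X) {t : StrongDual ℝ U} (ht : ∀ m, t (ν' m) = D.dualProj f (ν' m)) :
    ∃ g, D.dualProj g = t ∧ measure ν g = measure ν f := by
  obtain ⟨G, -, hG₁, hG₂⟩ := exists_reconstruction D ν hv
  refine ⟨G (t, measure ν f), hG₁ _ _, hG₂ _ _ (hw.mem_span hu fun m => ?_)⟩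
  rw [dotProduct_sub, dotProduct_measure, dotProduct_measure, ← hν', D.dualIncl_incl, ht,
    D.dualProj_apply, sub_self]

theorem exists_common_dualityMap (hν : LinearIndependent ℝ ν)
    (hv : LinearIndependent ℝ (crossVec D ν))
    (hu : Submodule.span ℝ (Set.range (crossVec D ν)) ⊔ Submodule.span ℝ (Set.range u) = ⊤)
    (hw : IsBiorthogonal (crossVec D ν) u w) (hν' : ∀ m, D.incl (ν' m) = ∑ j, w m j • ν j)
    (hE_proper : ∃ z, E y z ≠ ⊤) (hmono : StrictMono ψ) (hS : (solutionSet D ν E ψ y).Nonempty)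
    (hconst : ∀ f ∈ solutionSet D ν E ψ y, ∀ g ∈ solutionSet D ν E ψ y,
      measure ν f = measure ν g) :
    ∃ a : Fin K → ℝ, ∀ f ∈ solutionSet D ν E ψ y, D.dualProj f ∈ dualityMap (∑ m, a m • ν' m) := by
  obtain ⟨f₁, hf₁⟩ := hS
  obtain ⟨a, ha⟩ := exists_norming_combination ν' (D.dualProj f₁) fun t ht => by
    obtain ⟨g, rfl, hg⟩ := exists_dualProj_eq_measure_eq hv hu hw hν' f₁ ht
    exact semiNorm_le_of_mem_solutionSet hν hE_proper hmono hf₁ hg.symm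
  refine ⟨a, fun f hf => mem_dualityMap_iff.2 ?_⟩
  have hm := hconst f hf f₁ hf₁
  obtain ⟨h₁, h₂⟩ := mem_dualityMap_iff.1 ha
  have hle : ‖D.dualProj f‖ ≤ ‖D.dualProj f₁‖ :=
    semiNorm_le_of_mem_solutionSet hν hE_proper hmono hf hm
  refine ⟨hle.trans h₁, h₂.trans_eq ?_⟩
  simp only [map_sum, map_smul, apply_incl_eq_of_measure_eq hν' hm]

theorem exists_extremePoint_representation (hv : LinearIndependent ℝ (crossVec D ν))
    (hu : Submodule.span ℝ (Set.range (crossVec D ν)) ⊔ Submodule.span ℝ (Set.range u) = ⊤)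
    (hw : IsBiorthogonal (crossVec D ν) u w) (hν' : ∀ m, D.incl (ν' m) = ∑ j, w m j • ν j)
    (hmono : StrictMono ψ) {a : Fin K → ℝ}
    (ha : ∀ f ∈ solutionSet D ν E ψ y, D.dualProj f ∈ dualityMap (∑ m, a m • ν' m))
    {f₀ : StrongDual ℝ X} (hf₀ : f₀ ∈ (solutionSet D ν E ψ y).extremePoints ℝ) :
    ∃ K₀ ≤ K, ∃ (c : Fin K₀ → ℝ) (e : Fin K₀ → StrongDual ℝ U) (b : Fin N₀ → ℝ),
      (∀ k, e k ∈ (Metric.closedBall (0 : StrongDual ℝ U) 1).extremePoints ℝ) ∧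
      f₀ = ∑ k, c k • D.dualIncl (e k) + ∑ n, b n • D.p n := by
  have hs := ha f₀ hf₀.1
  obtain ⟨K₀, hK₀, c, e, he, hce⟩ := exists_sum_smul_extremePoints hs fun d hd hdν => by
    obtain ⟨ε, hε, h₁, h₂⟩ := hd
    obtain ⟨h, rfl, hh⟩ := exists_dualProj_eq_measure_eq hv hu hw hν' 0 (t := d)
      fun m => by rw [hdν]; rfl
    have hmem : ∀ r : ℝ, D.dualProj f₀ + r • D.dualProj h ∈ dualityMap (∑ m, a m • ν' m) →
        f₀ + r • h ∈ solutionSet D ν E ψ y := fun r hr => by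
      refine mem_solutionSet_of_semiNorm_le hmono.monotone hf₀.1 ?_ ?_
      · rw [measure_add, measure_smul, hh]
        funext m
        simp [measure]
      · exact (hr.1.trans hs.1.symm).le
    have hplus := hmem ε h₁
    have hminus := hmem (-ε) (by convert h₂ using 1; ext x; simp [sub_eq_add_neg])
    have heq := hf₀.2 hplus hminus ⟨1 / 2, 1 / 2, by norm_num, by norm_num, by norm_num, by module⟩
    have h0 : h = 0 := by simpa [hε.ne'] using heq
    rw [h0]
    rfl
  refine ⟨K₀, hK₀, c, e, fun n => f₀ (D.pstar n), he, ?_⟩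
  conv_lhs => rw [D.eq_dualIncl_add_sum f₀]
  congr 1
  rw [hce]
  ext x
  simp [SplitPair.dualIncl]

theorem exists_unique_null_coefficients {S : Set (StrongDual ℝ X)} (hS : S.Nonempty)
    (hconst : ∀ f ∈ S, ∀ g ∈ S, measure ν f = measure ν g)
    (hp : Submodule.span ℝ (Set.range D.pstar) ≤ Submodule.span ℝ (Set.range ν)) :
    ∃! b : Fin N₀ → ℝ, ∀ f₀ ∈ S, ∃ s₀ : StrongDual ℝ U,
      f₀ = D.dualIncl s₀ + ∑ n, b n • D.p n := by
  obtain ⟨f₁, hf₁⟩ := hS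
  refine ⟨fun n => f₁ (D.pstar n), fun f₀ hf₀ => ⟨D.dualProj f₀, ?_⟩, fun b hb => ?_⟩
  · have h : ∀ n, f₁ (D.pstar n) = f₀ (D.pstar n) := fun n => by
      obtain ⟨c, hc⟩ := (Submodule.mem_span_range_iff_exists_fun ℝ).1
        (hp (Submodule.subset_span (Set.mem_range_self n)))
      rw [← hc, ← dotProduct_measure, ← dotProduct_measure, hconst f₁ hf₁ f₀ hf₀]
    simp only [h]
    exact D.eq_dualIncl_add_sum f₀
  · obtain ⟨s, hs⟩ := hb f₁ hf₁
    exact funext (D.eq_of_eq_dualIncl_add_sum hs).2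

theorem exists_solutionSet_eq_singleton [StrictConvexSpace ℝ (StrongDual ℝ U)]
    (hv : LinearIndependent ℝ (crossVec D ν)) {S : Set (StrongDual ℝ X)} (hS : S.Nonempty)
    (hconst : ∀ f ∈ S, ∀ g ∈ S, measure ν f = measure ν g) {u₀ : U}
    (hJ : ∀ f ∈ S, D.dualProj f ∈ dualityMap u₀) {s : StrongDual ℝ U} (hs : s ∈ dualityMap u₀) :
    ∃ (f₀ : StrongDual ℝ X) (b : Fin N₀ → ℝ), S = {f₀} ∧
      f₀ = D.dualIncl s + ∑ n, b n • D.p n := by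
  obtain ⟨f₀, hf₀⟩ := hS
  refine ⟨f₀, fun n => f₀ (D.pstar n), Set.eq_singleton_iff_unique_mem.2 ⟨hf₀, fun f hf => ?_⟩, ?_⟩
  · exact eq_of_dualProj_eq_of_measure_eq hv
      (dualityMap_subsingleton u₀ (hJ f hf) (hJ f₀ hf₀)) (hconst f hf f₀ hf₀)
  · rw [dualityMap_subsingleton u₀ hs (hJ f₀ hf₀)]
    exact D.eq_dualIncl_add_sum f₀

theorem exists_unique_decomposition (f₀ : StrongDual ℝ X) :
    ∃ p₀ ∈ D.nullSpace, f₀ = p₀ + D.dualIncl (D.dualProj f₀) ∧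
      ∀ p₁ ∈ D.nullSpace, ∀ s₁ : StrongDual ℝ U,
        f₀ = p₁ + D.dualIncl s₁ → p₁ = p₀ ∧ s₁ = D.dualProj f₀ := by
  refine ⟨∑ n, f₀ (D.pstar n) • D.p n, ?_, ?_, fun p₁ hp₁ s₁ h => ?_⟩
  · exact (Submodule.mem_span_range_iff_exists_fun ℝ).2 ⟨_, rfl⟩
  · rw [add_comm]
    exact D.eq_dualIncl_add_sum f₀
  · obtain ⟨b, rfl⟩ := (Submodule.mem_span_range_iff_exists_fun ℝ).1 hp₁
    rw [add_comm] at h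
    obtain ⟨h₁, h₂⟩ := D.eq_of_eq_dualIncl_add_sum h
    exact ⟨by simp only [h₂], h₁⟩

end Structure

end SemiNormRep

open SemiNormRep in
theorem theorem3 {X U : Type*} [NormedAddCommGroup X] [NormedSpace ℝ X] [CompleteSpace X]
    [NormedAddCommGroup U] [NormedSpace ℝ U] [CompleteSpace U]
    {N₀ M : ℕ} (hM : N₀ < M) (D : SplitPair X U N₀)
    (ν : Fin M → X) (hν : LinearIndependent ℝ ν)
    (hv : LinearIndependent ℝ (crossVec D ν))
    (u : Fin (M - N₀) → Fin M → ℝ)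
    (hu : IsCompl (Submodule.span ℝ (Set.range (crossVec D ν))) (Submodule.span ℝ (Set.range u)))
    (E : (Fin M → ℝ) → (Fin M → ℝ) → ℝ≥0∞) (y : Fin M → ℝ)
    (hE_proper : ∃ z, E y z ≠ ⊤)
    (hE_lsc : LowerSemicontinuous (E y))
    (hE_coercive : Filter.Tendsto (E y) (Filter.cocompact (Fin M → ℝ)) (𝓝 ⊤))
    (hE_convex : ConvexOn ℝ≥0 Set.univ (E y))
    (ψ : ℝ≥0 → ℝ≥0) (hψ_mono : StrictMono ψ) (hψ_convex : ConvexOn ℝ≥0 Set.univ ψ) :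
    -- existence
    ((solutionSet D ν E ψ y).Nonempty ∧
      Convex ℝ (solutionSet D ν E ψ y) ∧
      IsCompact (StrongDual.toWeakDual '' solutionSet D ν E ψ y)) ∧
    -- the reduced basis
    (∃! w : Fin (M - N₀) → Fin M → ℝ, IsBiorthogonal (crossVec D ν) u w) ∧
    ∀ w : Fin (M - N₀) → Fin M → ℝ, IsBiorthogonal (crossVec D ν) u w →
    ∃ ν' : Fin (M - N₀) → U,
      (∀ m, D.incl (ν' m) = ∑ j, w m j • ν j) ∧ LinearIndependent ℝ ν' ∧
      -- representation of the solutions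
      (ExtStrictConvex (E y) ∨ (∀ z, z ≠ y → E y z = ⊤) →
        ∃ a : Fin (M - N₀) → ℝ,
          (∀ f₀ ∈ solutionSet D ν E ψ y, ∃ p₀ ∈ D.nullSpace, ∃ s₀ ∈ dualityMap (∑ m, a m • ν' m),
            f₀ = p₀ + D.dualIncl s₀ ∧
            ∀ p₁ ∈ D.nullSpace, ∀ s₁ : StrongDual ℝ U,
              f₀ = p₁ + D.dualIncl s₁ → p₁ = p₀ ∧ s₁ = s₀) ∧
          -- `U'` is a Hilbert space
          (InnerProductSpaceable (StrongDual ℝ U) → StrictConvexOn ℝ≥0 Set.univ ψ →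
            ∃ R : U ≃ₗᵢ[ℝ] StrongDual ℝ U, IsRieszMap R ∧
            ∃ (f₀ : StrongDual ℝ X) (b : Fin N₀ → ℝ), solutionSet D ν E ψ y = {f₀} ∧
              f₀ = ∑ m, a m • D.dualIncl (R (ν' m)) + ∑ n, b n • D.p n) ∧
          -- `U'` is strictly convex
          (StrictConvexSpace ℝ (StrongDual ℝ U) →
            ∃ J : U → StrongDual ℝ U, IsDualityOperator J ∧
            ∃ (f₀ : StrongDual ℝ X) (b : Fin N₀ → ℝ), solutionSet D ν E ψ y = {f₀} ∧
              f₀ = D.dualIncl (J (∑ m, a m • ν' m)) + ∑ n, b n • D.p n) ∧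
          -- the general case
          (StrongDual.toWeakDual '' solutionSet D ν E ψ y =
              closure (convexHull ℝ
                (StrongDual.toWeakDual '' (solutionSet D ν E ψ y).extremePoints ℝ)) ∧
            ∀ f₀ ∈ (solutionSet D ν E ψ y).extremePoints ℝ,
              ∃ K₀ ≤ M - N₀, ∃ (c : Fin K₀ → ℝ) (e : Fin K₀ → StrongDual ℝ U) (b : Fin N₀ → ℝ),
                (∀ k, e k ∈ (Metric.closedBall (0 : StrongDual ℝ U) 1).extremePoints ℝ) ∧
                f₀ = ∑ k, c k • D.dualIncl (e k) + ∑ n, b n • D.p n) ∧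
          -- uniqueness of the null-space coefficients
          (ExtStrictConvex (E y) →
            Submodule.span ℝ (Set.range D.pstar) ≤ Submodule.span ℝ (Set.range ν) →
            ∃! b : Fin N₀ → ℝ, ∀ f₀ ∈ solutionSet D ν E ψ y, ∃ s₀ : StrongDual ℝ U,
              f₀ = D.dualIncl s₀ + ∑ n, b n • D.p n)) := by
  have hne := solutionSet_nonempty hν hv hE_proper hE_lsc hE_coercive hψ_mono hψ_convex
  have hcv := solutionSet_convex (D := D) (ν := ν) hE_convex hψ_mono.monotone hψ_convex
  have hcp := solutionSet_isCompact hν hv hE_proper hE_lsc hE_coercive hψ_mono hψ_convex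
  have htop := hu.sup_eq_top
  refine ⟨⟨hne, hcv, hcp⟩, ?_, fun w hw => ?_⟩
  · obtain ⟨w, hw⟩ := exists_isBiorthogonal (Nat.add_sub_of_le hM.le) htop
    exact ⟨w, hw, fun w' hw' => hw'.eq hw htop⟩
  obtain ⟨ν', hν', hli⟩ := exists_reduced_basis hν hw
  refine ⟨ν', hν', hli, fun hE => ?_⟩
  have hconst : ∀ f ∈ solutionSet D ν E ψ y, ∀ g ∈ solutionSet D ν E ψ y,
      measure ν f = measure ν g := fun f hf g hg => by
    rcases hE with hE | hE
    · exact measure_eq_of_extStrictConvex hν hE_proper hE hψ_mono.monotone hψ_convex hf hg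
    · rw [measure_eq_of_constraint hν hE_proper hE hf, measure_eq_of_constraint hν hE_proper hE hg]
  obtain ⟨a, ha⟩ := exists_common_dualityMap hν hv htop hw hν' hE_proper hψ_mono hne hconst
  refine ⟨a, fun f₀ hf₀ => ?_, fun hH _ => ?_, fun hsc => ?_, ⟨?_, fun f₀ hf₀ => ?_⟩, fun _ hp => ?_⟩
  · obtain ⟨p₀, hp₀, h, huniq⟩ := exists_unique_decomposition (D := D) f₀
    exact ⟨p₀, hp₀, _, ha f₀ hf₀, h, huniq⟩
  · obtain ⟨R, hR⟩ := exists_isRieszMap (U := U)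
    obtain ⟨f₀, b, hS, hf₀⟩ := exists_solutionSet_eq_singleton hv hne hconst ha
      (hR.mem_dualityMap _)
    refine ⟨R, hR, f₀, b, hS, hf₀.trans ?_⟩
    congr 1
    ext x
    simp [SplitPair.dualIncl]
  · obtain ⟨J, hJ⟩ := exists_isDualityOperator (U := U)
    exact ⟨J, hJ, exists_solutionSet_eq_singleton hv hne hconst ha (by rw [hJ]; rfl)⟩
  · have : LocallyConvexSpace ℝ (WeakDual ℝ X) :=
      (WeakDual.withSeminorms ℝ X).toLocallyConvexSpace
    rw [image_extremePoints, closure_convexHull_extremePoints hcp]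
    exact hcv.linear_image (StrongDual.toWeakDual (𝕜 := ℝ) (E := X)).toLinearMap
  · exact exists_extremePoint_representation hv htop hw hν' hψ_mono ha hf₀
  · exact exists_unique_null_coefficients hne hconst hp
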